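/- **Setting.** Let $F:\mathsf{Set}\to\mathsf{Set}$ be a functor, $V$ a countable set of propositional variables, and $\Lambda$ a **finite** set of modal operators $\heartsuit$ with finite arities. Write $\mathcal Q$ for the contravariant powerset functor. Each $n$-ary $\heartsuit\in\Lambda$ is interpreted by an $n$-ary predicate lifting for $F$, that is, by a natural transformation $[\![\heartsuit]\!]:\mathcal Q(-)^n\to\mathcal Q\circ F$. *The logic.* The formulas of $\mathcal L(\Lambda)$ are given by $\phi,\psi::=v\mid\bot\mid\neg\phi\mid\phi\wedge\psi\mid\heartsuit(\phi_1,\dots,\phi_n)$ with $v\in V$ and $\heartsuit\in\Lambda$ $n$-ary; $\phi\to\psi$ abbreviates $\neg(\phi\wedge\neg\psi)$. For $V_0\subseteq V$, $\mathcal F(\Lambda,V_0)$ is the set of formulas that mention only variables from $V_0$. An $F$-model consists of a set $X$, a map $\xi:X\to FX$ and a valuation $\tau:V\to\mathcal P(X)$. Satisfaction is defined by the usual clauses together with $x\models\heartsuit(\phi_1,\dots,\phi_n)$ iff $\xi(x)\in[\![\heartsuit]\!]_X([\![\phi_1]\!],\dots,[\![\phi_n]\!])$, where $[\![\phi_i]\!]=\{y\in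 X\mid y\models\phi_i\}$. We write $\models\phi$ if $\phi$ holds at every state of every $F$-model. *One-step formulas.* $\mathsf{Prop}(Z)$ denotes the set of propositional formulas (built from $\bot,\neg,\wedge$) over a set $Z$, and $\Lambda(Z)=\{\heartsuit(z_1,\dots,z_n)\mid\heartsuit\in\Lambda\ n\text{-ary},\ z_i\in Z\}$. A valuation $\tau:V\to\mathcal P(X)$ extends to $\mathsf{Prop}(V)$ in the Boolean algebra $\mathcal P(X)$, and then to $\psi\in\mathsf{Prop}(\Lambda(\mathsf{Prop}(V)))$, with value $\psi\tau\in\mathcal P(FX)$, by the Boolean clauses and $(\heartsuit(\phi_1,\dots,\phi_n))\tau=[\![\heartsuit]\!]_X(\phi_1\tau,\dots,\phi_n\tau)$. We write $\models\psi$ if $\psi\tau=FX$ for all sets $X$ and all $\tau:V\to\mathcal P(X)$. For a Boolean subalgebra $\mathfrak A\subseteq\mathcal P(X)$, a formula $\psi\in\mathsf{Prop}(\Lambda(\mathfrak A))$ is interpreted in $\mathcal P(FX)$ in the same way, with every $A\in\mathfrak A$ interpreted as itself; we write $FX\models\psi$ if its value is $FX$. *Properties.* * $\Lambda$ is *monotone*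 if $[\![\heartsuit]\!]_X(A_1,\dots,A_n)\subseteq[\![\heartsuit]\!]_X(B_1,\dots,B_n)$ for all $\heartsuit\in\Lambda$, all sets $X$, and all $A_i\subseteq B_i\subseteq X$. * $\Lambda$ is *separating* if for every set $X$ the maps $t\mapsto\{(A_1,\dots,A_n)\mid t\in[\![\heartsuit]\!]_X(A_1,\dots,A_n)\}$ on $FX$, $\heartsuit\in\Lambda$, are jointly injective. * $F$ *preserves finite surjective weak pullbacks* if it maps every pullback square of finite sets over a cospan $X\xrightarrow{f}Z\xleftarrow{g}Y$ of surjective maps to a weak pullback square (mediating maps exist, not necessarily uniquely). * Boolean subalgebras $\mathfrak A_1,\mathfrak A_2$ of $\mathcal P(X)$ are *interpolable* if whenever $A\subseteq B$ with $A\in\mathfrak A_1$, $B\in\mathfrak A_2$, there is $C\in\mathfrak A_1\cap\mathfrak A_2$ with $A\subseteq C\subseteq B$. $\mathcal L(\Lambda)$ has *one-step interpolation* if for every set $X$, all interpolable $\mathfrak A_1,\mathfrak A_2\subseteq\mathcal P(X)$, and all $\phi\in\mathsf{Prop}(\Lambda(\mathfrak A_1))$, $\psi\in\mathsf{Prop}(\Lambda(\mathfrak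 A_2))$ with $FX\models\phi\to\psi$, there is $\rho\in\mathsf{Prop}(\Lambda(\mathfrak A_1\cap\mathfrak A_2))$ with $FX\models\phi\to\rho$ and $FX\models\rho\to\psi$. * $\mathcal L(\Lambda)$ has *interpolation* if for all $V_1,V_2\subseteq V$, $\phi\in\mathcal F(\Lambda,V_1)$, $\psi\in\mathcal F(\Lambda,V_2)$ with $\models\phi\to\psi$ there is $\rho\in\mathcal F(\Lambda,V_1\cap V_2)$ with $\models\phi\to\rho$ and $\models\rho\to\psi$. It has *uniform interpolation* if $\rho$ can be chosen to depend only on $\phi$ and on $V_0:=V_1\cap V_2$. * The one-step logic $\mathsf{Prop}(\Lambda(\mathsf{Prop}(V)))$ has *interpolation* if for all $V_1,V_2\subseteq V$, $\phi\in\mathsf{Prop}(\Lambda(\mathsf{Prop}(V_1)))$, $\psi\in\mathsf{Prop}(\Lambda(\mathsf{Prop}(V_2)))$ with $\models\phi\to\psi$ there is $\rho\in\mathsf{Prop}(\Lambda(\mathsf{Prop}(V_1\cap V_2)))$ with $\models\phi\to\rho$ and $\models\rho\to\psi$. **Theorem.** Let $\Lambda$ be finite. Then $(1)\Rightarrow(2)\Rightarrow(3)\Rightarrow(4)\Rightarrow(5)$,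 where 1. $\Lambda$ is separating and $F$ preserves finite surjective weak pullbacks; 2. $\mathcal L(\Lambda)$ has one-step interpolation; 3. $\mathcal L(\Lambda)$ has uniform interpolation; 4. $\mathcal L(\Lambda)$ has interpolation; 5. the one-step logic $\mathsf{Prop}(\Lambda(\mathsf{Prop}(V)))$ has interpolation. Moreover, if $\Lambda$ is monotone and separating, then $(2)\Rightarrow(1)$. -/

import Mathlib

open CategoryTheory

universe u v w

namespace CoalgLogic

/-! ### Weak pullbacks -/

/-- A square is a weak pullback if it commutes and mediating morphisms exist
(not necessarily uniquely). -/
structure IsWeakPullback {C : Type v} [Category.{w} C] {P X Y Z : C}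
    (fst : P ⟶ X) (snd : P ⟶ Y) (f : X ⟶ Z) (g : Y ⟶ Z) : Prop
    extends CommSq fst snd f g where
  isWeakLimit' : Nonempty (Limits.IsWeakLimit (Limits.PullbackCone.mk _ _ w))

/-- The set functor `F` sends every pullback square of finite sets whose cospan consists of
surjective maps to a weak pullback square. -/
def PreservesFiniteSurjectiveWeakPullbacks (F : Type u ⥤ Type u) : Prop :=
  ∀ (P X Y Z : Type u) (π₁ : P ⟶ X) (π₂ : P ⟶ Y) (f : X ⟶ Z) (g : Y ⟶ Z),
    Finite P → Finite X → Finite Y → Finite Z →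
    Function.Surjective f → Function.Surjective g → IsPullback π₁ π₂ f g →
    IsWeakPullback (F.map π₁) (F.map π₂) (F.map f) (F.map g)

/-! ### Modal signatures and predicate liftings -/

/-- A modal signature: modal operators with finite arities. -/
structure ModalSignature where
  Op : Type w
  arity : Op → ℕ

/-- An `n`-ary predicate lifting for `F`: a natural transformation `𝒬(-)ⁿ → 𝒬 ∘ F`, where `𝒬` is
the contravariant powerset functor. -/
structure PredicateLifting (F : Type u ⥤ Type u) (n : ℕ) where
  app : ∀ X : Type u, (Fin n → Set X) → Set (F.obj X)
  natural : ∀ (X Y : Type u) (f : X ⟶ Y) (B : Fin n → Set Y),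
    app X (fun i => f ⁻¹' B i) = F.map f ⁻¹' app Y B

/-- Monotonicity of a predicate lifting. -/
def PredicateLifting.IsMonotone {F : Type u ⥤ Type u} {n : ℕ} (l : PredicateLifting F n) : Prop :=
  ∀ (X : Type u) (A B : Fin n → Set X), (∀ i, A i ⊆ B i) → l.app X A ⊆ l.app X B

/-- An interpretation of the signature `Λ` over `F`: a predicate lifting of the right arity for
each modal operator. -/
abbrev Interpretation (F : Type u ⥤ Type u) (Λ : ModalSignature.{w}) :=
  ∀ o : Λ.Op, PredicateLifting F (Λ.arity o)

section

variable {F : Type u ⥤ Type u} {Λ : ModalSignature.{w}}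

/-- `Λ` is monotone: all modalities are interpreted by monotone predicate liftings. -/
def Monotonic (sem : Interpretation F Λ) : Prop :=
  ∀ o : Λ.Op, (sem o).IsMonotone

/-- `Λ` is separating: for each set `X`, the transposites
`t ↦ {A | t ∈ ⟦♡⟧_X (A)}`, for `♡ ∈ Λ`, are jointly injective on `F X`. -/
def Separating (sem : Interpretation F Λ) : Prop :=
  ∀ (X : Type u) (s t : F.obj X),
    (∀ o : Λ.Op, {A | s ∈ (sem o).app X A} = {A | t ∈ (sem o).app X A}) → s = t

end

/-! ### Propositional and one-step formulas -/

/-- `Prop(Z)`: propositional formulas over `Z`. -/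
inductive PropFormula (Z : Type v) : Type v
  | atom (z : Z) : PropFormula Z
  | bot : PropFormula Z
  | neg (φ : PropFormula Z) : PropFormula Z
  | and (φ ψ : PropFormula Z) : PropFormula Z

namespace PropFormula

variable {Z : Type v}

/-- `φ → ψ`, i.e. `¬(φ ∧ ¬ψ)`. -/
def imp (φ ψ : PropFormula Z) : PropFormula Z := neg (and φ (neg ψ))

/-- The set of atoms that occur in a formula. -/
def atoms : PropFormula Z → Set Z
  | atom z => {z}
  | bot => ∅
  | neg φ => φ.atoms
  | and φ ψ => φ.atoms ∪ ψ.atoms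

/-- The extension of a formula under a powerset valuation. -/
def ext {X : Type u} (τ : Z → Set X) : PropFormula Z → Set X
  | atom z => τ z
  | bot => ∅
  | neg φ => (φ.ext τ)ᶜ
  | and φ ψ => φ.ext τ ∩ ψ.ext τ

/-- `Prop(S)` for a subset `S` of `Z`. -/
def overSet (S : Set Z) : Set (PropFormula Z) := {φ | φ.atoms ⊆ S}

end PropFormula

/-- `Λ(Z)`: formulas `♡(z₁, …, zₙ)` with `♡ ∈ Λ` of arity `n` and `zᵢ ∈ Z`. -/
structure Modalized (Λ : ModalSignature.{w}) (Z : Type v) where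
  op : Λ.Op
  args : Fin (Λ.arity op) → Z

namespace Modalized

variable {F : Type u ⥤ Type u} {Λ : ModalSignature.{w}} {Z : Type v}

/-- `♡(z₁, …, zₙ)` is interpreted by applying the predicate lifting of `♡` to the values of the
arguments. -/
def ext (sem : Interpretation F Λ) {X : Type u} (τ : Z → Set X) (m : Modalized Λ Z) :
    Set (F.obj X) :=
  (sem m.op).app X (fun i => τ (m.args i))

/-- `Λ(S)` for a subset `S` of `Z`. -/
def overSet (S : Set Z) : Set (Modalized Λ Z) := {m | ∀ i, m.args i ∈ S}

end Modalized

/-! ### One-step interpolation over Boolean subalgebras of powersets -/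

/-- Two Boolean subalgebras `𝔄₁`, `𝔄₂` of `𝒫 X` are interpolable if every inclusion `A ⊆ B` with
`A ∈ 𝔄₁`, `B ∈ 𝔄₂` has an intermediate set in `𝔄₁ ∩ 𝔄₂`. -/
def Interpolable {X : Type u} (𝔄₁ 𝔄₂ : BooleanSubalgebra (Set X)) : Prop :=
  ∀ A ∈ 𝔄₁, ∀ B ∈ 𝔄₂, A ⊆ B → ∃ C ∈ 𝔄₁ ⊓ 𝔄₂, A ⊆ C ∧ C ⊆ B

section

variable {F : Type u ⥤ Type u} {Λ : ModalSignature.{w}}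

/-- The set `Prop(Λ(𝔄))` of one-step formulas over a Boolean subalgebra `𝔄` of `𝒫 X`. -/
def AlgOneStep (Λ : ModalSignature.{w}) {X : Type u} (𝔄 : BooleanSubalgebra (Set X)) :
    Set (PropFormula (Modalized Λ (Set X))) :=
  PropFormula.overSet (Modalized.overSet (𝔄 : Set (Set X)))

/-- `F X ⊨ φ` for `φ ∈ Prop(Λ(𝒫 X))`, where every subset of `X` is interpreted as itself. -/
def AlgValid (sem : Interpretation F Λ) {X : Type u}
    (φ : PropFormula (Modalized Λ (Set X))) : Prop :=
  φ.ext (Modalized.ext sem (fun A : Set X => A)) = Set.univ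

/-- `ℒ(Λ)` has one-step interpolation. -/
def OneStepInterpolation (sem : Interpretation F Λ) : Prop :=
  ∀ (X : Type u) (𝔄₁ 𝔄₂ : BooleanSubalgebra (Set X)), Interpolable 𝔄₁ 𝔄₂ →
    ∀ φ ∈ AlgOneStep Λ 𝔄₁, ∀ ψ ∈ AlgOneStep Λ 𝔄₂, AlgValid sem (φ.imp ψ) →
      ∃ ρ ∈ AlgOneStep Λ (𝔄₁ ⊓ 𝔄₂), AlgValid sem (φ.imp ρ) ∧ AlgValid sem (ρ.imp ψ)

end

/-! ### The one-step logic `Prop(Λ(Prop(V)))` -/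

section

variable {F : Type u ⥤ Type u} {Λ : ModalSignature.{w}} {V : Type v}

/-- `Prop(Λ(Prop(V)))`. -/
abbrev OneStepFormula (Λ : ModalSignature.{w}) (V : Type v) :=
  PropFormula (Modalized Λ (PropFormula V))

/-- `Prop(Λ(Prop(V₀)))` for a subset `V₀` of `V`. -/
def OneStepFormula.overSet (V₀ : Set V) : Set (OneStepFormula Λ V) :=
  PropFormula.overSet (Modalized.overSet (PropFormula.overSet V₀))

/-- The extension of a one-step formula in `𝒫 (F X)` under a valuation `τ : V → 𝒫 X`. -/
def OneStepFormula.extension (sem : Interpretation F Λ) {X : Type u} (τ : V → Set X)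
    (φ : OneStepFormula Λ V) : Set (F.obj X) :=
  PropFormula.ext (Modalized.ext sem (PropFormula.ext τ)) φ

/-- One-step validity: validity over all powerset valuations. -/
def OneStepFormula.Valid (sem : Interpretation F Λ) (φ : OneStepFormula Λ V) : Prop :=
  ∀ (X : Type u) (τ : V → Set X), OneStepFormula.extension sem τ φ = Set.univ

/-- The one-step logic `Prop(Λ(Prop(V)))` has interpolation. -/
def OneStepLogicInterpolation (V : Type v) (sem : Interpretation F Λ) : Prop :=
  ∀ (V₁ V₂ : Set V) (φ ψ : OneStepFormula Λ V),
    φ ∈ OneStepFormula.overSet V₁ → ψ ∈ OneStepFormula.overSet V₂ →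
    OneStepFormula.Valid sem (PropFormula.imp φ ψ) →
      ∃ ρ ∈ OneStepFormula.overSet (V₁ ∩ V₂),
        OneStepFormula.Valid sem (PropFormula.imp φ ρ) ∧
        OneStepFormula.Valid sem (PropFormula.imp ρ ψ)

end

/-! ### The full logic `ℒ(Λ)` -/

/-- Modal `Λ`-formulas over the propositional variables `V`. -/
inductive Formula (Λ : ModalSignature.{w}) (V : Type v) : Type (max v w)
  | var (p : V) : Formula Λ V
  | bot : Formula Λ V
  | neg (φ : Formula Λ V) : Formula Λ V
  | and (φ ψ : Formula Λ V) : Formula Λ V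
  | modal (o : Λ.Op) (φ : Fin (Λ.arity o) → Formula Λ V) : Formula Λ V

/-- An `F`-model: an `F`-coalgebra `(X, ξ)` with a valuation of the propositional variables. The
carrier may be empty. -/
structure CoalgModel (F : Type u ⥤ Type u) (V : Type v) where
  frame : Endofunctor.Coalgebra F
  val : V → Set frame.V

namespace Formula

variable {F : Type u ⥤ Type u} {Λ : ModalSignature.{w}} {V : Type v}

/-- `φ → ψ`, i.e. `¬(φ ∧ ¬ψ)`. -/
def imp (φ ψ : Formula Λ V) : Formula Λ V := neg (and φ (neg ψ))

/-- The set of propositional variables mentioned in a formula. -/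
def vars : Formula Λ V → Set V
  | var p => {p}
  | bot => ∅
  | neg φ => φ.vars
  | and φ ψ => φ.vars ∪ ψ.vars
  | modal _ φ => ⋃ i, (φ i).vars

/-- The set of formulas that mention only variables from `V₀`. -/
def overSet (V₀ : Set V) : Set (Formula Λ V) := {φ | φ.vars ⊆ V₀}

/-- The set of states of a model that satisfy a formula. -/
def ext (sem : Interpretation F Λ) (M : CoalgModel F V) : Formula Λ V → Set M.frame.V
  | var p => M.val p
  | bot => ∅
  | neg φ => (φ.ext sem M)ᶜ
  | and φ ψ => φ.ext sem M ∩ ψ.ext sem M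
  | modal o φ => {x | M.frame.str x ∈ (sem o).app M.frame.V (fun i => (φ i).ext sem M)}

/-- Validity: satisfaction at every state of every `F`-model. -/
def Valid (sem : Interpretation F Λ) (φ : Formula Λ V) : Prop :=
  ∀ (M : CoalgModel F V) (x : M.frame.V), x ∈ φ.ext sem M

end Formula

section

variable {F : Type u ⥤ Type u} {Λ : ModalSignature.{w}}

/-- `ℒ(Λ)` has interpolation. -/
def Interpolation (V : Type v) (sem : Interpretation F Λ) : Prop :=
  ∀ (V₁ V₂ : Set V) (φ ψ : Formula Λ V), φ ∈ Formula.overSet V₁ → ψ ∈ Formula.overSet V₂ →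
    (φ.imp ψ).Valid sem →
      ∃ ρ ∈ Formula.overSet (V₁ ∩ V₂), (φ.imp ρ).Valid sem ∧ (ρ.imp ψ).Valid sem

/-- `ℒ(Λ)` has uniform interpolation: the interpolant of `φ` and `ψ` can be chosen to depend only
on `φ` and on `V₀ = V₁ ∩ V₂`. -/
def UniformInterpolation (V : Type v) (sem : Interpretation F Λ) : Prop :=
  ∀ (φ : Formula Λ V) (V₀ : Set V), ∃ ρ ∈ Formula.overSet V₀,
    ∀ (V₁ V₂ : Set V) (ψ : Formula Λ V), φ ∈ Formula.overSet V₁ → ψ ∈ Formula.overSet V₂ →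
      V₁ ∩ V₂ = V₀ → (φ.imp ψ).Valid sem → (φ.imp ρ).Valid sem ∧ (ρ.imp ψ).Valid sem

end

end CoalgLogic

/-!
The chain of implications rests on a reformulation of one-step interpolation by sets
(`oneStepInterpolation_iff`): for interpolable `𝔄₁`, `𝔄₂`, an inclusion between a member of
`oneStepAlgebra 𝔄₁` and a member of `oneStepAlgebra 𝔄₂` factors through `oneStepAlgebra (𝔄₁ ⊓ 𝔄₂)`.
Definability is obtained throughout from `mem_of_profile`: a set belongs to a Boolean algebra of sets
as soon as membership in it depends only on membership in finitely many sets of the algebra.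

*Weak pullbacks and one-step interpolation.* Two one-step formulas factor through finite quotients
`T₁`, `T₂` of `X`. Interpolability allows one to choose a finite partition `T₀` of `X` into common
cells, and to refine `T₁` and `T₂` by it, such that `X` maps onto the pullback `T₁ ×_{T₀} T₂`
(`exists_independent_partition`). The image of the first formula in `F T₀` is definable because `F T₀`
is separated by finitely many liftings, and it implies the second formula because elements of `F X`
with the same image in `F T₀` can be amalgamated. Conversely, over a pullback `P` of finite sets the
algebras `𝒫 X` and `𝒫 Y` are interpolable with intersection `𝒫 Z`, and a pair of elements of `F X`
and `F Y` that agree in `F Z` but have no common preimage in `F P` would contradict one-step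
interpolation.

*Uniform interpolation.* There is a model in which every formula that is not valid is refuted, the
disjoint union of countably many countermodels. In it, the extensions of the formulas over given
variables and of bounded depth form an algebra. By induction on the depth of `φ`, a valid implication
`φ → ψ` has an interpolant of at most the depth of `φ` (`Formula.exists_interpolant`): adding a root
to the model shows that the implication is valid as a one-step implication for each choice of truth
values of the variables, the algebras of extensions are interpolable by the induction hypothesis, and
one-step interpolation applies. Since finitely many formulas of bounded depth over finitely many
variables suffice up to equivalence, the strongest of these consequences of `φ` is a uniform
interpolant.

*The one-step logic.* An interpolant in the full logic is made into a one-step formula by evaluating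
it at a root over the model `collapseModel`, where all modal formulas are constant
(`Formula.mem_extension_toOneStep`).
-/

namespace CoalgLogic

/-! ### Finite families in Boolean algebras of sets -/

/-- A set that is a union of classes of the equivalence relation "to belong to the same members of
a finite family" lies in every Boolean algebra of sets that contains the family. -/
lemma mem_of_profile {Y : Type*} {ι : Type*} [Finite ι] (𝔅 : BooleanSubalgebra (Set Y))
    {G : ι → Set Y} (hG : ∀ i, G i ∈ 𝔅) {D : Set Y}
    (hD : ∀ x y, (∀ i, x ∈ G i ↔ y ∈ G i) → x ∈ D → y ∈ D) : D ∈ 𝔅 := by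
  classical
  have hinter : ∀ {κ : Type _} [Finite κ] (f : κ → Set Y), (∀ k, f k ∈ 𝔅) → ⋂ k, f k ∈ 𝔅 := by
    intro κ _ f hf
    have := Fintype.ofFinite κ
    have h : Finset.univ.inf f ∈ (𝔅 : Set (Set Y)) :=
      Finset.inf_mem _ 𝔅.top_mem (fun _ hx _ hy => 𝔅.inf_mem hx hy) _ _ (fun k _ => hf k)
    simpa [Finset.inf_eq_iInf] using h
  let cell : Set ι → Set Y := fun c => ⋂ i, if i ∈ c then G i else (G i)ᶜ
  have hcell : ∀ c, cell c ∈ 𝔅 := fun c => hinter _ fun i => by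
    split_ifs
    exacts [hG i, 𝔅.compl_mem (hG i)]
  have mem_cell : ∀ c x, x ∈ cell c ↔ ∀ i, x ∈ G i ↔ i ∈ c := by
    intro c x
    simp only [cell, Set.mem_iInter]
    refine forall_congr' fun i => ?_
    split_ifs with h <;> simp [h]
  have hDc : Dᶜ = ⋂ x : (fun x => {i | x ∈ G i}) '' D, (cell x.1)ᶜ := by
    ext y
    simp only [Set.mem_compl_iff, Set.mem_iInter, mem_cell]
    constructor
    · rintro hy ⟨_, x, hx, rfl⟩ h
      exact hy (hD x y (fun i => (h i).symm) hx)
    · intro h hy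
      exact h ⟨_, y, hy, rfl⟩ fun i => Iff.rfl
  rw [← 𝔅.compl_mem_iff, hDc]
  exact hinter _ fun x => 𝔅.compl_mem (hcell _)

/-- A finite family of sets generates only finitely many unions of classes of the relation "to
belong to the same members". -/
lemma finite_of_profile {Y : Type u} {ι : Type*} [Finite ι] (G : ι → Set Y) :
    {D : Set Y | ∀ x y, (∀ i, x ∈ G i ↔ y ∈ G i) → x ∈ D → y ∈ D}.Finite := by
  refine (Set.finite_range fun T : Set (Set ι) => {y | {i | y ∈ G i} ∈ T}).subset ?_
  intro D hD
  refine ⟨(fun x => {i | x ∈ G i}) '' D, ?_⟩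
  ext y
  constructor
  · rintro ⟨x, hx, hxy⟩
    exact hD x y (fun i => Set.ext_iff.1 hxy i) hx
  · exact fun hy => ⟨y, hy, rfl⟩

/-! ### Definable sets of one-step formulas -/

namespace PropFormula

variable {Z : Type v}

/-- The Boolean algebra of the extensions of the propositional formulas with atoms in `S`. -/
def definable {Y : Type u} (τ : Z → Set Y) (S : Set Z) : BooleanSubalgebra (Set Y) where
  carrier := {D | ∃ φ ∈ overSet S, φ.ext τ = D}
  supClosed' := by
    rintro _ ⟨φ, hφ, rfl⟩ _ ⟨ψ, hψ, rfl⟩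
    refine ⟨neg (and (neg φ) (neg ψ)), Set.union_subset hφ hψ, ?_⟩
    simp [ext, Set.compl_inter]
  infClosed' := by
    rintro _ ⟨φ, hφ, rfl⟩ _ ⟨ψ, hψ, rfl⟩
    exact ⟨and φ ψ, Set.union_subset hφ hψ, rfl⟩
  compl_mem' := by
    rintro _ ⟨φ, hφ, rfl⟩
    exact ⟨neg φ, hφ, rfl⟩
  bot_mem' := ⟨bot, Set.empty_subset _, rfl⟩

lemma ext_mem_definable {Y : Type u} {τ : Z → Set Y} {S : Set Z} {φ : PropFormula Z}
    (hφ : φ ∈ overSet S) : φ.ext τ ∈ definable τ S := ⟨φ, hφ, rfl⟩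

lemma atom_mem_definable {Y : Type u} {τ : Z → Set Y} {S : Set Z} {z : Z} (hz : z ∈ S) :
    τ z ∈ definable τ S := ⟨atom z, Set.singleton_subset_iff.2 hz, rfl⟩

lemma preimage_mem_of_mem_definable {Y Y' : Type*} {τ : Z → Set Y} {S : Set Z}
    {𝔅 : BooleanSubalgebra (Set Y')} (g : Y' → Y) (h : ∀ z ∈ S, g ⁻¹' τ z ∈ 𝔅) {D : Set Y}
    (hD : D ∈ definable τ S) : g ⁻¹' D ∈ 𝔅 := by
  obtain ⟨φ, hφ, rfl⟩ := hD
  induction φ with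
  | atom z => exact h z (hφ rfl)
  | bot => exact 𝔅.bot_mem
  | neg φ ih => exact 𝔅.compl_mem (ih hφ)
  | and φ ψ ih₁ ih₂ =>
    exact 𝔅.inf_mem (ih₁ (Set.subset_union_left.trans hφ)) (ih₂ (Set.subset_union_right.trans hφ))

lemma definable_le {Y : Type u} {τ : Z → Set Y} {S : Set Z} {𝔅 : BooleanSubalgebra (Set Y)}
    (h : ∀ z ∈ S, τ z ∈ 𝔅) : definable τ S ≤ 𝔅 :=
  fun _ hD => preimage_mem_of_mem_definable id h hD

lemma ext_imp_eq_univ {Y : Type u} {τ : Z → Set Y} {φ ψ : PropFormula Z} :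
    (φ.imp ψ).ext τ = Set.univ ↔ φ.ext τ ⊆ ψ.ext τ := by
  rw [show (φ.imp ψ).ext τ = (φ.ext τ ∩ (ψ.ext τ)ᶜ)ᶜ from rfl, Set.compl_univ_iff,
    ← Set.sdiff_eq, Set.sdiff_eq_empty]

lemma finite_atoms (φ : PropFormula Z) : φ.atoms.Finite := by
  induction φ with
  | atom z => exact Set.finite_singleton z
  | bot => exact Set.finite_empty
  | neg φ ih => exact ih
  | and φ ψ ih₁ ih₂ => exact ih₁.union ih₂

end PropFormula

section

variable {F : Type u ⥤ Type u} {Λ : ModalSignature.{w}}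

lemma PredicateLifting.map_mem_app {n : ℕ} (l : PredicateLifting F n) {X Y : Type u} (f : X ⟶ Y)
    (t : F.obj X) (B : Fin n → Set Y) :
    F.map f t ∈ l.app Y B ↔ t ∈ l.app X (fun i => f ⁻¹' B i) := by
  rw [l.natural]
  rfl

variable (sem : Interpretation F Λ)

/-- The Boolean algebra of the values in `𝒫 (F X)` of the formulas in `Prop(Λ(𝔄))`. -/
def oneStepAlgebra {X : Type u} (𝔄 : BooleanSubalgebra (Set X)) :
    BooleanSubalgebra (Set (F.obj X)) :=
  PropFormula.definable (Modalized.ext sem fun A : Set X => A)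
    (Modalized.overSet (𝔄 : Set (Set X)))

variable {sem}

lemma app_mem_oneStepAlgebra {X : Type u} {𝔄 : BooleanSubalgebra (Set X)} (o : Λ.Op)
    {A : Fin (Λ.arity o) → Set X} (hA : ∀ i, A i ∈ 𝔄) :
    (sem o).app X A ∈ oneStepAlgebra sem 𝔄 :=
  PropFormula.atom_mem_definable (τ := Modalized.ext sem fun A : Set X => A) (z := ⟨o, A⟩) hA

lemma oneStepAlgebra_le {X : Type u} {𝔄 : BooleanSubalgebra (Set X)}
    {𝔅 : BooleanSubalgebra (Set (F.obj X))}
    (h : ∀ (o : Λ.Op) (A : Fin (Λ.arity o) → Set X), (∀ i, A i ∈ 𝔄) → (sem o).app X A ∈ 𝔅) :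
    oneStepAlgebra sem 𝔄 ≤ 𝔅 :=
  PropFormula.definable_le fun z hz => h z.op z.args hz

lemma oneStepAlgebra_mono {X : Type u} {𝔄 𝔅 : BooleanSubalgebra (Set X)} (h : 𝔄 ≤ 𝔅) :
    oneStepAlgebra sem 𝔄 ≤ oneStepAlgebra sem 𝔅 :=
  oneStepAlgebra_le fun o _ hA => app_mem_oneStepAlgebra o fun i => h (hA i)

/-- One-step interpolation, expressed by sets instead of formulas. -/
lemma oneStepInterpolation_iff : OneStepInterpolation sem ↔
    ∀ (X : Type u) (𝔄₁ 𝔄₂ : BooleanSubalgebra (Set X)), Interpolable 𝔄₁ 𝔄₂ →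
      ∀ D₁ ∈ oneStepAlgebra sem 𝔄₁, ∀ D₂ ∈ oneStepAlgebra sem 𝔄₂, D₁ ⊆ D₂ →
        ∃ D ∈ oneStepAlgebra sem (𝔄₁ ⊓ 𝔄₂), D₁ ⊆ D ∧ D ⊆ D₂ := by
  refine forall₄_congr fun X 𝔄₁ 𝔄₂ _ => ?_
  constructor
  · rintro h _ ⟨φ, hφ, rfl⟩ _ ⟨ψ, hψ, rfl⟩ hle
    obtain ⟨ρ, hρ, h₁, h₂⟩ := h φ hφ ψ hψ (PropFormula.ext_imp_eq_univ.2 hle)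
    exact ⟨_, ⟨ρ, hρ, rfl⟩, PropFormula.ext_imp_eq_univ.1 h₁, PropFormula.ext_imp_eq_univ.1 h₂⟩
  · intro h φ hφ ψ hψ hle
    obtain ⟨_, ⟨ρ, hρ, rfl⟩, h₁, h₂⟩ := h _ ⟨φ, hφ, rfl⟩ _ ⟨ψ, hψ, rfl⟩
      (PropFormula.ext_imp_eq_univ.1 hle)
    exact ⟨ρ, hρ, PropFormula.ext_imp_eq_univ.2 h₁, PropFormula.ext_imp_eq_univ.2 h₂⟩

/-- The Boolean algebra of the preimages under `p`. -/
def preimageAlgebra {X T : Type u} (p : X → T) : BooleanSubalgebra (Set X) where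
  carrier := Set.range (Set.preimage p)
  supClosed' := by
    rintro _ ⟨A, rfl⟩ _ ⟨B, rfl⟩
    exact ⟨A ∪ B, rfl⟩
  infClosed' := by
    rintro _ ⟨A, rfl⟩ _ ⟨B, rfl⟩
    exact ⟨A ∩ B, rfl⟩
  compl_mem' := by
    rintro _ ⟨A, rfl⟩
    exact ⟨Aᶜ, rfl⟩
  bot_mem' := ⟨∅, rfl⟩

lemma preimage_mem_preimageAlgebra {X T : Type u} (p : X → T) (B : Set T) :
    p ⁻¹' B ∈ preimageAlgebra p := ⟨B, rfl⟩

/-- The one-step formulas over preimages under `p` define preimages under `F p`. -/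
lemma oneStepAlgebra_preimageAlgebra_le {X T : Type u} (p : X ⟶ T) :
    oneStepAlgebra sem (preimageAlgebra p) ≤ preimageAlgebra (F.map p) := by
  refine oneStepAlgebra_le fun o A hA => ?_
  choose B hB using hA
  refine ⟨(sem o).app T B, ?_⟩
  rw [← (sem o).natural]
  simp only [hB]

/-- If finitely many liftings separate the points of `F T` and `T` is finite, then every preimage
under `F p` is definable by a one-step formula. -/
lemma preimage_mem_oneStepAlgebra [Finite Λ.Op] (hsep : Separating sem) {X T : Type u} [Finite T]
    (p : X ⟶ T) {𝔄 : BooleanSubalgebra (Set X)} (hp : ∀ B : Set T, p ⁻¹' B ∈ 𝔄)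
    (D : Set (F.obj T)) : F.map p ⁻¹' D ∈ oneStepAlgebra sem 𝔄 := by
  refine mem_of_profile (ι := Σ o : Λ.Op, Fin (Λ.arity o) → Set T) _
    (G := fun m => (sem m.1).app X fun i => p ⁻¹' m.2 i)
    (fun m => app_mem_oneStepAlgebra _ fun i => hp _) ?_
  intro x y hxy hx
  have : F.map p x = F.map p y := hsep T _ _ fun o => Set.ext fun A => by
    simpa only [Set.mem_ofPred_eq, PredicateLifting.map_mem_app] using hxy ⟨o, A⟩
  rwa [Set.mem_preimage, ← this]

end

/-! ### Weak pullbacks of sets -/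

lemma isWeakPullback_iff {P X Y Z : Type u} (fst : P ⟶ X) (snd : P ⟶ Y) (f : X ⟶ Z) (g : Y ⟶ Z) :
    IsWeakPullback fst snd f g ↔
      fst ≫ f = snd ≫ g ∧ ∀ x y, f x = g y → ∃ p, fst p = x ∧ snd p = y := by
  constructor
  · intro h
    refine ⟨h.w, fun x y hxy => ?_⟩
    obtain ⟨hl⟩ := h.isWeakLimit'
    let c := Limits.PullbackCone.mk (f := f) (g := g) (↾fun _ : PUnit.{u + 1} => x)
      (↾fun _ : PUnit.{u + 1} => y) (by ext; exact hxy)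
    exact ⟨hl.lift c PUnit.unit,
      congr($(hl.fac c Limits.WalkingCospan.left) PUnit.unit),
      congr($(hl.fac c Limits.WalkingCospan.right) PUnit.unit)⟩
  · rintro ⟨hw, h⟩
    refine ⟨⟨hw⟩, ⟨?_⟩⟩
    have hex : ∀ (s : Limits.PullbackCone f g) (t : s.pt), ∃ p, fst p = Limits.PullbackCone.fst s t ∧
        snd p = Limits.PullbackCone.snd s t :=
      fun s t => h _ _ congr($(Limits.PullbackCone.condition s) t)
    choose l hl₁ hl₂ using hex
    refine ⟨fun s => ↾(l s), fun s j => ?_⟩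
    have h₁ : (↾(l s)) ≫ fst = Limits.PullbackCone.fst s := by ext t; exact hl₁ s t
    have h₂ : (↾(l s)) ≫ snd = Limits.PullbackCone.snd s := by ext t; exact hl₂ s t
    rcases j with _ | _ | _
    · have h₀ : (↾(l s)) ≫ fst ≫ f = s.π.app Limits.WalkingCospan.one := by
        rw [← Category.assoc, h₁]
        exact s.w Limits.WalkingCospan.Hom.inl
      exact h₀
    · exact h₁
    · exact h₂

lemma map_surjective (F : Type u ⥤ Type u) {X Y : Type u} {f : X ⟶ Y}
    (hf : Function.Surjective f) : Function.Surjective (F.map f) := by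
  intro t
  refine ⟨F.map (↾Function.surjInv hf) t, ?_⟩
  have : (↾Function.surjInv hf) ≫ f = 𝟙 Y := by
    ext y
    exact Function.surjInv_eq hf y
  rw [← comp_apply, ← F.map_comp, this, F.map_id, id_apply]

/-- If `X` maps onto the pullback of a cospan of finite sets and surjections, and `F` preserves
finite surjective weak pullbacks, then two elements of `F X` with equal images at the corner of the
cospan can be amalgamated in `F X`. -/
lemma PreservesFiniteSurjectiveWeakPullbacks.exists_amalgam {F : Type u ⥤ Type u}
    (hF : PreservesFiniteSurjectiveWeakPullbacks F) {X T₁ T₂ T₀ : Type u} [Finite T₁] [Finite T₂]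
    [Finite T₀] (r₁ : X ⟶ T₁) (r₂ : X ⟶ T₂) (f : T₁ ⟶ T₀) (g : T₂ ⟶ T₀)
    (hf : Function.Surjective f) (hg : Function.Surjective g) (hfg : r₁ ≫ f = r₂ ≫ g)
    (hX : ∀ a b, f a = g b → ∃ x, r₁ x = a ∧ r₂ x = b) (s t : F.obj X)
    (hst : F.map (r₁ ≫ f) s = F.map (r₂ ≫ g) t) :
    ∃ u, F.map r₁ u = F.map r₁ s ∧ F.map r₂ u = F.map r₂ t := by
  let P := {ab : T₁ × T₂ // f ab.1 = g ab.2}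
  let π₁ : P ⟶ T₁ := ↾fun ab => ab.1.1
  let π₂ : P ⟶ T₂ := ↾fun ab => ab.1.2
  have hP : IsPullback π₁ π₂ f g := by
    rw [Limits.Types.isPullback_iff]
    refine ⟨by ext ab; exact ab.2, fun ab ab' h => ?_, fun a b h => ⟨⟨(a, b), h⟩, rfl, rfl⟩⟩
    exact Subtype.ext (Prod.ext h.1 h.2)
  have hwp := hF P T₁ T₂ T₀ π₁ π₂ f g inferInstance inferInstance inferInstance inferInstance hf hg hP
  obtain ⟨p, hp₁, hp₂⟩ := ((isWeakPullback_iff _ _ _ _).1 hwp).2 (F.map r₁ s) (F.map r₂ t)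
    (by simpa only [F.map_comp, comp_apply] using hst)
  let r : X ⟶ P := ↾fun x => ⟨(r₁ x, r₂ x), congr($hfg x)⟩
  have hr : Function.Surjective r := by
    rintro ⟨⟨a, b⟩, hab⟩
    obtain ⟨x, rfl, rfl⟩ := hX a b hab
    exact ⟨x, rfl⟩
  obtain ⟨u, rfl⟩ := map_surjective F hr p
  refine ⟨u, ?_, ?_⟩
  · rw [← hp₁, ← comp_apply, ← F.map_comp]
    rfl
  · rw [← hp₂, ← comp_apply, ← F.map_comp]
    rfl

/-! ### Weak pullback preservation and one-step interpolation -/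

/-- Interpolable algebras admit finite partitions with cells in the common part such that, on each
cell, the values of two given finite-valued measurable maps vary independently.

A cell on which the values `p₁ x` and `p₂ y` are both attained but not at a common point is split by
an interpolant of the two fibres: on one part the value `p₂ y` is lost, on the other the value
`p₁ x`. Hence the number of attained values decreases and the splitting terminates. -/
lemma exists_independent_partition {X : Type u} {𝔄₁ 𝔄₂ : BooleanSubalgebra (Set X)}
    (h : Interpolable 𝔄₁ 𝔄₂) {T₁ T₂ : Type u} [Finite T₁] [Finite T₂] (p₁ : X → T₁) (p₂ : X → T₂)
    (hp₁ : ∀ B, p₁ ⁻¹' B ∈ 𝔄₁) (hp₂ : ∀ B, p₂ ⁻¹' B ∈ 𝔄₂) (c : Set X) (hc : c ∈ 𝔄₁ ⊓ 𝔄₂) :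
    ∃ (T₀ : Type u) (_ : Finite T₀) (q : X → T₀), (∀ B, q ⁻¹' B ∩ c ∈ 𝔄₁ ⊓ 𝔄₂) ∧
      ∀ x ∈ c, ∀ y ∈ c, q x = q y → ∃ z ∈ c, q z = q x ∧ p₁ z = p₁ x ∧ p₂ z = p₂ y := by
  classical
  induction hn : (p₁ '' c).ncard + (p₂ '' c).ncard using Nat.strong_induction_on generalizing c with
  | _ n ih =>
  by_cases hfine : ∀ x ∈ c, ∀ y ∈ c, ∃ z ∈ c, p₁ z = p₁ x ∧ p₂ z = p₂ y
  · refine ⟨PUnit, inferInstance, fun _ => PUnit.unit, fun B => ?_, fun x hx y hy _ => ?_⟩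
    · by_cases hB : PUnit.unit ∈ B
      · simpa [Set.preimage, hB] using hc
      · have : (fun _ : X => PUnit.unit) ⁻¹' B ∩ c = ⊥ := by simp [Set.preimage, hB]
        rw [this]
        exact BooleanSubalgebra.bot_mem
    · obtain ⟨z, hz, h₁, h₂⟩ := hfine x hx y hy
      exact ⟨z, hz, rfl, h₁, h₂⟩
  · push Not at hfine
    obtain ⟨x, hx, y, hy, hxy⟩ := hfine
    obtain ⟨C, hC, hxC, hCy⟩ := h (p₁ ⁻¹' {p₁ x} ∩ c) (𝔄₁.inf_mem (hp₁ _) hc.1)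
      (p₂ ⁻¹' {p₂ y} ∩ c)ᶜ (𝔄₂.compl_mem (𝔄₂.inf_mem (hp₂ _) hc.2))
      (fun z hz hz' => hxy z hz.2 hz.1 hz'.1)
    have hc₁ : c ∩ C ∈ 𝔄₁ ⊓ 𝔄₂ := BooleanSubalgebra.inf_mem hc hC
    have hc₂ : c ∩ Cᶜ ∈ 𝔄₁ ⊓ 𝔄₂ := BooleanSubalgebra.inf_mem hc (BooleanSubalgebra.compl_mem hC)
    have hlt₁ : (p₂ '' (c ∩ C)).ncard < (p₂ '' c).ncard := by
      refine Set.ncard_lt_ncard ((Set.ssubset_iff_of_subset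
        (Set.image_mono Set.inter_subset_left)).2 ⟨p₂ y, ⟨y, hy, rfl⟩, ?_⟩) (Set.toFinite _)
      rintro ⟨z, hz, hzy⟩
      exact hCy hz.2 ⟨hzy, hz.1⟩
    have hlt₂ : (p₁ '' (c ∩ Cᶜ)).ncard < (p₁ '' c).ncard := by
      refine Set.ncard_lt_ncard ((Set.ssubset_iff_of_subset
        (Set.image_mono Set.inter_subset_left)).2 ⟨p₁ x, ⟨x, hx, rfl⟩, ?_⟩) (Set.toFinite _)
      rintro ⟨z, hz, hzx⟩
      exact hz.2 (hxC ⟨hzx, hz.1⟩)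
    have hle₁ : (p₁ '' (c ∩ C)).ncard ≤ (p₁ '' c).ncard :=
      Set.ncard_le_ncard (Set.image_mono Set.inter_subset_left) (Set.toFinite _)
    have hle₂ : (p₂ '' (c ∩ Cᶜ)).ncard ≤ (p₂ '' c).ncard :=
      Set.ncard_le_ncard (Set.image_mono Set.inter_subset_left) (Set.toFinite _)
    obtain ⟨T, hT, q, hq, hqf⟩ := ih _ (by omega) (c ∩ C) hc₁ rfl
    obtain ⟨T', hT', q', hq', hqf'⟩ := ih _ (by omega) (c ∩ Cᶜ) hc₂ rfl
    refine ⟨T ⊕ T', inferInstance, fun z => if z ∈ C then .inl (q z) else .inr (q' z),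
      fun B => ?_, fun a ha b hb hab => ?_⟩
    · convert BooleanSubalgebra.sup_mem (hq (Sum.inl ⁻¹' B)) (hq' (Sum.inr ⁻¹' B)) using 1
      ext z
      by_cases hz : z ∈ C <;> simp [hz]
    · by_cases haC : a ∈ C <;> by_cases hbC : b ∈ C <;> simp [haC, hbC] at hab
      · obtain ⟨z, hz, h₁, h₂⟩ := hqf a ⟨ha, haC⟩ b ⟨hb, hbC⟩ hab
        exact ⟨z, hz.1, by simp [haC, hz.2, h₁], h₂⟩
      · obtain ⟨z, hz, h₁, h₂⟩ := hqf' a ⟨ha, haC⟩ b ⟨hb, hbC⟩ hab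
        have hzC : z ∉ C := hz.2
        exact ⟨z, hz.1, by simp [haC, hzC, h₁], h₂⟩

section

variable {F : Type u ⥤ Type u} {Λ : ModalSignature.{w}} {sem : Interpretation F Λ}

/-- A one-step formula mentions only finitely many sets, so that it only depends on a finite
quotient. -/
lemma exists_finite_quotient {X : Type u} {𝔄 : BooleanSubalgebra (Set X)} {D : Set (F.obj X)}
    (hD : D ∈ oneStepAlgebra sem 𝔄) :
    ∃ (T : Type u) (_ : Finite T) (p : X ⟶ T), (∀ B : Set T, p ⁻¹' B ∈ 𝔄) ∧
      D ∈ preimageAlgebra (F.map p) := by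
  obtain ⟨φ, hφ, rfl⟩ := hD
  let S : Set (Set X) := ⋃ m ∈ φ.atoms, Set.range m.args
  have hS : S.Finite := φ.finite_atoms.biUnion fun m _ => Set.finite_range _
  have := hS.to_subtype
  let p : X ⟶ Set S := ↾fun x => {A : S | x ∈ A.1}
  refine ⟨Set S, inferInstance, p, fun B => ?_, oneStepAlgebra_preimageAlgebra_le (sem := sem) p ?_⟩
  · refine mem_of_profile 𝔄 (G := fun A : S => A.1) ?_ ?_
    · rintro ⟨A, hA⟩
      obtain ⟨m, hm, i, rfl⟩ := Set.mem_iUnion₂.1 hA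
      exact hφ hm i
    · intro x y hxy hx
      have : p x = p y := Set.ext hxy
      rwa [Set.mem_preimage, ← this]
  · refine PropFormula.ext_mem_definable fun m hm i => ?_
    exact ⟨{c | ∃ h, (⟨m.args i, h⟩ : S) ∈ c}, Set.ext fun x =>
      ⟨fun ⟨_, hx⟩ => hx, fun hx => ⟨Set.mem_iUnion₂.2 ⟨m, hm, i, rfl⟩, hx⟩⟩⟩

theorem oneStepInterpolation_of_preserves [Finite Λ.Op] (hsep : Separating sem)
    (hF : PreservesFiniteSurjectiveWeakPullbacks F) : OneStepInterpolation sem := by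
  rw [oneStepInterpolation_iff]
  intro X 𝔄₁ 𝔄₂ hint D₁ hD₁ D₂ hD₂ hle
  obtain ⟨T₁, _, p₁, hp₁, E₁, rfl⟩ := exists_finite_quotient hD₁
  obtain ⟨T₂, _, p₂, hp₂, E₂, rfl⟩ := exists_finite_quotient hD₂
  obtain ⟨T₀, _, q, hq, hqf⟩ := exists_independent_partition hint p₁ p₂ hp₁ hp₂ Set.univ
    BooleanSubalgebra.top_mem
  simp only [Set.inter_univ, Set.mem_univ, true_and, forall_const] at hq hqf
  -- The finite quotients of `X` by `(p₁, q)`, by `(p₂, q)` and by `q`.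
  let r₁ : X ⟶ Set.range fun x : X => (p₁ x, q x) := ↾fun x => ⟨(p₁ x, q x), x, rfl⟩
  let r₂ : X ⟶ Set.range fun x : X => (p₂ x, q x) := ↾fun x => ⟨(p₂ x, q x), x, rfl⟩
  let r₀ : X ⟶ Set.range q := ↾fun x => ⟨q x, x, rfl⟩
  let f : ↥(Set.range fun x : X => (p₁ x, q x)) ⟶ ↥(Set.range q) :=
    ↾fun a : Set.range fun x : X => (p₁ x, q x) =>
      (⟨a.1.2, by obtain ⟨_, x, rfl⟩ := a; exact ⟨x, rfl⟩⟩ : Set.range q)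
  let g : ↥(Set.range fun x : X => (p₂ x, q x)) ⟶ ↥(Set.range q) :=
    ↾fun a : Set.range fun x : X => (p₂ x, q x) =>
      (⟨a.1.2, by obtain ⟨_, x, rfl⟩ := a; exact ⟨x, rfl⟩⟩ : Set.range q)
  have hf : Function.Surjective f := by
    rintro ⟨_, x, rfl⟩
    exact ⟨r₁ x, rfl⟩
  have hg : Function.Surjective g := by
    rintro ⟨_, x, rfl⟩
    exact ⟨r₂ x, rfl⟩
  have hX : ∀ a b, f a = g b → ∃ x, r₁ x = a ∧ r₂ x = b := by
    rintro ⟨_, x, rfl⟩ ⟨_, y, rfl⟩ hxy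
    have hxy : q x = q y := congrArg Subtype.val hxy
    obtain ⟨z, hz, hz₁, hz₂⟩ := hqf x y hxy
    exact ⟨z, Subtype.ext (Prod.ext hz₁ hz), Subtype.ext (Prod.ext hz₂ (hz.trans hxy))⟩
  have hp₁r : p₁ = r₁ ≫ (↾fun a : Set.range fun x : X => (p₁ x, q x) => a.1.1) := rfl
  have hp₂r : p₂ = r₂ ≫ (↾fun a : Set.range fun x : X => (p₂ x, q x) => a.1.1) := rfl
  refine ⟨F.map r₀ ⁻¹' (F.map r₀ '' (F.map p₁ ⁻¹' E₁)),
    preimage_mem_oneStepAlgebra hsep r₀ (fun B => ?_) _, Set.subset_preimage_image _ _, ?_⟩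
  · convert hq (Subtype.val '' B) using 1
    ext x
    exact ⟨fun hx => ⟨_, hx, rfl⟩, fun ⟨b, hb, hbx⟩ => by
      rwa [Set.mem_preimage, show r₀ x = b from Subtype.ext hbx.symm]⟩
  · rintro t ⟨s, hs, hst⟩
    obtain ⟨u, hu₁, hu₂⟩ := hF.exists_amalgam r₁ r₂ f g hf hg rfl hX s t hst
    have hu : u ∈ F.map p₁ ⁻¹' E₁ := by
      rw [Set.mem_preimage, hp₁r, F.map_comp, comp_apply, hu₁, ← comp_apply, ← F.map_comp]
      exact hs
    have := hle hu
    rwa [Set.mem_preimage, hp₂r, F.map_comp, comp_apply, hu₂, ← comp_apply, ← F.map_comp] at this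

/-- Given `a ∈ F X` and `b ∈ F Y` with the same image in `F Z`, the sets of those elements of `F P`
that are mapped to `a` and to `b`, respectively, are definable over `𝒫 X` and `𝒫 Y`. If they were
disjoint, the first could be separated from the second by a formula over `𝒫 Z`; but membership in a
set defined by such a formula depends only on the image in `F Z`. -/
theorem preserves_of_oneStepInterpolation [Finite Λ.Op] (hsep : Separating sem)
    (hint : OneStepInterpolation sem) : PreservesFiniteSurjectiveWeakPullbacks F := by
  intro P X Y Z π₁ π₂ f g _ _ _ _ hf hg hP
  rw [isWeakPullback_iff, ← F.map_comp, ← F.map_comp, hP.w]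
  refine ⟨rfl, fun a b hab => ?_⟩
  by_contra! hcon
  have hπ₁ : Function.Surjective π₁ := fun x => by
    obtain ⟨y, hy⟩ := hg (f x)
    obtain ⟨p, hp, _⟩ := Limits.Types.exists_of_isPullback hP x y hy.symm
    exact ⟨p, hp⟩
  have hπ₂ : Function.Surjective π₂ := fun y => by
    obtain ⟨x, hx⟩ := hf (g y)
    obtain ⟨p, _, hp⟩ := Limits.Types.exists_of_isPullback hP x y hx
    exact ⟨p, hp⟩
  have hw : ∀ p, f (π₁ p) = g (π₂ p) := fun p => congr($(hP.w) p)
  have key : ∀ A B, π₁ ⁻¹' A ⊆ π₂ ⁻¹' B → (π₁ ≫ f) ⁻¹' (f '' A) ⊆ π₂ ⁻¹' B := by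
    rintro A B hAB p ⟨x, hx, hxp⟩
    obtain ⟨p', hp₁, hp₂⟩ := Limits.Types.exists_of_isPullback hP x (π₂ p) (hxp.trans (hw p))
    have := hAB (show π₁ p' ∈ A from hp₁ ▸ hx)
    rwa [Set.mem_preimage, hp₂] at this
  have hI : Interpolable (preimageAlgebra π₁) (preimageAlgebra π₂) := by
    rintro _ ⟨A, rfl⟩ _ ⟨B, rfl⟩ hAB
    refine ⟨(π₁ ≫ f) ⁻¹' (f '' A), ⟨⟨f ⁻¹' (f '' A), rfl⟩, ⟨g ⁻¹' (f '' A), ?_⟩⟩, ?_, key A B hAB⟩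
    · rw [hP.w]
      rfl
    · exact fun p hp => ⟨_, hp, rfl⟩
  have hinf : preimageAlgebra π₁ ⊓ preimageAlgebra π₂ ≤ preimageAlgebra (π₁ ≫ f) := by
    rintro _ ⟨⟨A, rfl⟩, ⟨B, hB⟩⟩
    refine ⟨f '' A, Set.Subset.antisymm ?_ fun p hp => ⟨_, hp, rfl⟩⟩
    exact (key A B hB.ge).trans hB.le
  obtain ⟨D, hD, haD, hDb⟩ := oneStepInterpolation_iff.1 hint P _ _ hI
    (F.map π₁ ⁻¹' {a}) (preimage_mem_oneStepAlgebra hsep π₁ (preimage_mem_preimageAlgebra _) _)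
    (F.map π₂ ⁻¹' {b})ᶜ (BooleanSubalgebra.compl_mem
      (preimage_mem_oneStepAlgebra hsep π₂ (preimage_mem_preimageAlgebra _) _))
    (fun c hca hcb => hcon c hca hcb)
  obtain ⟨E, rfl⟩ : D ∈ preimageAlgebra (F.map (π₁ ≫ f)) :=
    oneStepAlgebra_preimageAlgebra_le _ (oneStepAlgebra_mono hinf hD)
  obtain ⟨s, rfl⟩ := map_surjective F hπ₁ a
  obtain ⟨t, rfl⟩ := map_surjective F hπ₂ b
  have hs : F.map (π₁ ≫ f) s ∈ E := haD rfl
  refine hDb (a := t) ?_ rfl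
  have hst : F.map (π₁ ≫ f) t = F.map (π₁ ≫ f) s := by
    have hs : F.map (π₁ ≫ f) s = F.map f (F.map π₁ s) := by rw [F.map_comp, comp_apply]
    rw [hs, hab, hP.w, F.map_comp, comp_apply]
  rwa [Set.mem_preimage, hst]

end

/-! ### Constructions on models -/

section

variable {F : Type u ⥤ Type u} {Λ : ModalSignature.{w}} {V : Type v}
  {sem : Interpretation F Λ}

/-- Morphisms of models preserve and reflect satisfaction. -/
lemma Formula.ext_eq_preimage {M N : CoalgModel F V} (h : M.frame.V ⟶ N.frame.V)
    (hstr : ∀ x, N.frame.str (h x) = F.map h (M.frame.str x))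
    (hval : ∀ p, M.val p = h ⁻¹' N.val p) (φ : Formula Λ V) :
    φ.ext sem M = h ⁻¹' φ.ext sem N := by
  induction φ with
  | var p => exact hval p
  | bot => rfl
  | neg φ ih => simp only [Formula.ext, ih, Set.preimage_compl]
  | and φ ψ ih₁ ih₂ => simp only [Formula.ext, ih₁, ih₂, Set.preimage_inter]
  | modal o φ ih =>
    ext x
    simp only [Formula.ext, ih]
    change _ ↔ N.frame.str (h x) ∈ (sem o).app _ fun i => (φ i).ext sem N
    rw [hstr, PredicateLifting.map_mem_app]
    rfl

lemma Formula.valid_imp_iff {φ ψ : Formula Λ V} :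
    (φ.imp ψ).Valid sem ↔ ∀ M : CoalgModel F V, φ.ext sem M ⊆ ψ.ext sem M := by
  refine forall_congr' fun M => forall_congr' fun x => ?_
  change ¬(x ∈ φ.ext sem M ∧ ¬x ∈ ψ.ext sem M) ↔ _
  rw [not_and_not_right]

/-- The extension of a formula at a fresh root state: the pair `(s, t)` stands for a state with
successor structure `t` at which exactly the variables in `s` hold. -/
def Formula.rootExt (sem : Interpretation F Λ) (M : CoalgModel F V) :
    Formula Λ V → Set (Set V × F.obj M.frame.V)
  | var p => {q | p ∈ q.1}
  | bot => ∅
  | neg φ => (φ.rootExt sem M)ᶜ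
  | and φ ψ => φ.rootExt sem M ∩ ψ.rootExt sem M
  | modal o φ => {q | q.2 ∈ (sem o).app M.frame.V (fun i => (φ i).ext sem M)}

lemma Formula.mem_ext_iff_mem_rootExt {M : CoalgModel F V} (φ : Formula Λ V) (x : M.frame.V) :
    x ∈ φ.ext sem M ↔ ({p | x ∈ M.val p}, M.frame.str x) ∈ φ.rootExt sem M := by
  induction φ with
  | var p => rfl
  | bot => rfl
  | neg φ ih => exact not_congr ih
  | and φ ψ ih₁ ih₂ => exact and_congr ih₁ ih₂
  | modal o φ ih => rfl

/-- The model `M` with an additional root, which has successor structure `t` in `M` and satisfies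
exactly the variables in `s`. -/
def CoalgModel.addRoot (M : CoalgModel F V) (s : Set V) (t : F.obj M.frame.V) :
    CoalgModel F V where
  frame :=
    { V := Option M.frame.V
      str := ↾fun x => F.map (↾some) (x.elim t M.frame.str) }
  val p := {x | x.elim (p ∈ s) (· ∈ M.val p)}

lemma CoalgModel.none_mem_ext_addRoot {M : CoalgModel F V} {s : Set V} {t : F.obj M.frame.V}
    (φ : Formula Λ V) : (none : Option M.frame.V) ∈ φ.ext sem (M.addRoot s t) ↔
      (s, t) ∈ φ.rootExt sem M := by
  induction φ with
  | var p => rfl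
  | bot => rfl
  | neg φ ih => exact not_congr ih
  | and φ ψ ih₁ ih₂ => exact and_congr ih₁ ih₂
  | modal o φ ih =>
    have h : ∀ χ : Formula Λ V, χ.ext sem M = some ⁻¹' χ.ext sem (M.addRoot s t) :=
      fun χ => χ.ext_eq_preimage (N := M.addRoot s t) (↾some) (fun _ => rfl) (fun _ => rfl)
    refine (PredicateLifting.map_mem_app (sem o) (X := M.frame.V) (Y := Option M.frame.V) (↾some) t
      fun i => (φ i).ext sem (M.addRoot s t)).trans ?_
    change _ ↔ t ∈ (sem o).app M.frame.V fun i => (φ i).ext sem M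
    simp only [h]
    rfl

lemma Formula.rootExt_subset_of_valid {φ ψ : Formula Λ V} (h : (φ.imp ψ).Valid sem)
    (M : CoalgModel F V) : φ.rootExt sem M ⊆ ψ.rootExt sem M := by
  rintro ⟨s, t⟩ hφ
  rw [← CoalgModel.none_mem_ext_addRoot] at hφ ⊢
  exact Formula.valid_imp_iff.1 h _ hφ

/-- The disjoint union of a sequence of models. -/
def CoalgModel.sigma (M : ℕ → CoalgModel F V) : CoalgModel F V where
  frame :=
    { V := Σ k, (M k).frame.V
      str := ↾fun x => F.map (↾Sigma.mk x.1) ((M x.1).frame.str x.2) }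
  val p := {x | x.2 ∈ (M x.1).val p}

/-! ### A universal model -/

/-- An encoding of formulas by natural numbers. -/
def Formula.code [Encodable V] [Encodable Λ.Op] : Formula Λ V → ℕ
  | var p => Nat.pair 0 (Encodable.encode p)
  | bot => Nat.pair 1 0
  | neg φ => Nat.pair 2 φ.code
  | and φ ψ => Nat.pair 3 (Nat.pair φ.code ψ.code)
  | modal o φ => Nat.pair 4 (Nat.pair (Encodable.encode o) (Encodable.encode fun i => (φ i).code))

lemma Formula.code_injective [Encodable V] [Encodable Λ.Op] :
    Function.Injective (code : Formula Λ V → ℕ) := by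
  intro φ
  induction φ with
  | var p =>
    intro ψ h
    cases ψ <;> simp [code, Nat.pair_eq_pair] at h
    rw [h]
  | bot =>
    intro ψ h
    cases ψ <;> simp [code, Nat.pair_eq_pair] at h
    rfl
  | neg φ ih =>
    intro ψ h
    cases ψ <;> simp [code, Nat.pair_eq_pair] at h
    rw [ih h]
  | and φ₁ φ₂ ih₁ ih₂ =>
    intro ψ h
    cases ψ <;> simp [code, Nat.pair_eq_pair] at h
    rw [ih₁ h.1, ih₂ h.2]
  | modal o φ ih =>
    intro ψ h
    cases ψ <;> simp [code, Nat.pair_eq_pair] at h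
    obtain ⟨rfl, h⟩ := h
    congr 1
    funext i
    exact ih i (congrFun (Encodable.encode_inj.1 h) i)

instance [Countable V] [Countable Λ.Op] : Countable (Formula Λ V) := by
  have := Encodable.ofCountable V
  have := Encodable.ofCountable Λ.Op
  exact Formula.code_injective.countable

/-- A model is universal if it refutes every formula that is not valid. -/
def CoalgModel.IsUniversal (sem : Interpretation F Λ) (M : CoalgModel F V) : Prop :=
  ∀ φ : Formula Λ V, φ.ext sem M = Set.univ → φ.Valid sem

/-- As there are only countably many formulas, the disjoint union of models that refute the formulas
that are not valid is universal. -/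
lemma exists_isUniversal [Countable V] [Countable Λ.Op] (sem : Interpretation F Λ) :
    ∃ M : CoalgModel F V, M.IsUniversal sem := by
  have hrefute : ∀ φ : Formula Λ V, ∃ M : CoalgModel F V,
      φ.ext sem M = Set.univ → φ.Valid sem := by
    intro φ
    by_cases hφ : φ.Valid sem
    · exact ⟨⟨⟨PEmpty, ↾PEmpty.elim⟩, fun _ => ∅⟩, fun _ => hφ⟩
    · simp only [Formula.Valid, not_forall] at hφ
      obtain ⟨M, x, hx⟩ := hφ
      exact ⟨M, fun h => absurd (h ▸ Set.mem_univ x) hx⟩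
  choose M hM using hrefute
  have : Nonempty (Formula Λ V) := ⟨.bot⟩
  obtain ⟨e, he⟩ := exists_surjective_nat (Formula Λ V)
  refine ⟨.sigma fun k => M (e k), fun φ hφ => ?_⟩
  obtain ⟨k, rfl⟩ := he φ
  refine hM _ ?_
  rw [Formula.ext_eq_preimage (N := .sigma fun k => M (e k)) 
    (↾fun x => (⟨k, x⟩ : Σ k, (M (e k)).frame.V)) (fun _ => rfl) (fun _ => rfl), hφ, Set.preimage_univ]

lemma CoalgModel.IsUniversal.valid_imp {M : CoalgModel F V} (hM : M.IsUniversal sem)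
    {φ ψ : Formula Λ V} (h : φ.ext sem M ⊆ ψ.ext sem M) : (φ.imp ψ).Valid sem :=
  hM _ (Set.eq_univ_of_forall fun _ hx => hx.2 (h hx.1))

/-! ### Formulas of bounded depth -/

namespace Formula

/-- The depth of a formula: the nesting depth of modal operators and propositional variables, where
a variable counts like a modal operator without arguments. Thus the formulas of depth `0` are the
Boolean combinations of `⊥`. -/
def depth : Formula Λ V → ℕ
  | var _ => 1
  | bot => 0
  | neg φ => φ.depth
  | and φ ψ => max φ.depth ψ.depth
  | modal _ φ => (Finset.univ.sup fun i => (φ i).depth) + 1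

lemma vars_eq_empty_of_depth {φ : Formula Λ V} (h : φ.depth ≤ 0) : φ.vars = ∅ := by
  induction φ with
  | var p => simp [depth] at h
  | bot => rfl
  | neg φ ih => exact ih h
  | and φ ψ ih₁ ih₂ =>
    simp only [depth, max_le_iff] at h
    simp [vars, ih₁ h.1, ih₂ h.2]
  | modal o φ => simp [depth] at h

lemma depth_modal_le {o : Λ.Op} {φ : Fin (Λ.arity o) → Formula Λ V} {n : ℕ} :
    (modal o φ).depth ≤ n + 1 ↔ ∀ i, (φ i).depth ≤ n := by
  simp [depth]

lemma finite_vars (φ : Formula Λ V) : φ.vars.Finite := by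
  induction φ with
  | var p => exact Set.finite_singleton p
  | bot => exact Set.finite_empty
  | neg φ ih => exact ih
  | and φ ψ ih₁ ih₂ => exact ih₁.union ih₂
  | modal o φ ih => exact Set.finite_iUnion ih

/-- The Boolean algebra of the values of the formulas over `V₀` of depth at most `n`, for an
interpretation `e` of formulas that respects the Boolean connectives. -/
def boundedAlgebra {Y : Type*} (e : Formula Λ V → Set Y) (hbot : e bot = ∅)
    (hneg : ∀ φ, e (neg φ) = (e φ)ᶜ) (hand : ∀ φ ψ, e (and φ ψ) = e φ ∩ e ψ) (n : ℕ)
    (V₀ : Set V) : BooleanSubalgebra (Set Y) where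
  carrier := {A | ∃ χ : Formula Λ V, χ.depth ≤ n ∧ χ.vars ⊆ V₀ ∧ e χ = A}
  supClosed' := by
    rintro _ ⟨φ, hφ, hφ', rfl⟩ _ ⟨ψ, hψ, hψ', rfl⟩
    refine ⟨neg (and (neg φ) (neg ψ)), max_le hφ hψ, Set.union_subset hφ' hψ', ?_⟩
    simp [hneg, hand, Set.compl_inter]
  infClosed' := by
    rintro _ ⟨φ, hφ, hφ', rfl⟩ _ ⟨ψ, hψ, hψ', rfl⟩
    exact ⟨and φ ψ, max_le hφ hψ, Set.union_subset hφ' hψ', hand φ ψ⟩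
  compl_mem' := by
    rintro _ ⟨φ, hφ, hφ', rfl⟩
    exact ⟨neg φ, hφ, hφ', hneg φ⟩
  bot_mem' := ⟨bot, Nat.zero_le _, Set.empty_subset _, hbot⟩

/-- The Boolean algebra of the extensions in `M` of the formulas over `V₀` of depth at most `n`. -/
def extAlgebra (sem : Interpretation F Λ) (M : CoalgModel F V) (n : ℕ) (V₀ : Set V) :
    BooleanSubalgebra (Set M.frame.V) :=
  boundedAlgebra (ext sem M) rfl (fun _ => rfl) (fun _ _ => rfl) n V₀

/-- The Boolean algebra of the extensions at a fresh root over `M` of the formulas over `V₀` of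
depth at most `n`. -/
def rootAlgebra (sem : Interpretation F Λ) (M : CoalgModel F V) (n : ℕ) (V₀ : Set V) :
    BooleanSubalgebra (Set (Set V × F.obj M.frame.V)) :=
  boundedAlgebra (rootExt sem M) rfl (fun _ => rfl) (fun _ _ => rfl) n V₀

/-- For a fixed set of true variables, a formula of depth at most `n + 1` is a one-step formula over
the extensions of formulas of depth at most `n`. -/
lemma slice_mem_oneStepAlgebra {M : CoalgModel F V} {n : ℕ} {V₀ : Set V} {χ : Formula Λ V}
    (hn : χ.depth ≤ n + 1) (hV : χ.vars ⊆ V₀) (s : Set V) :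
    {t | (s, t) ∈ χ.rootExt sem M} ∈ oneStepAlgebra sem (extAlgebra sem M n V₀) := by
  induction χ with
  | var p =>
    by_cases hp : p ∈ s
    · convert BooleanSubalgebra.top_mem
      exact Set.eq_univ_of_forall fun _ => hp
    · convert BooleanSubalgebra.bot_mem
      exact Set.eq_empty_of_forall_notMem fun _ => hp
  | bot => exact BooleanSubalgebra.bot_mem
  | neg φ ih => exact BooleanSubalgebra.compl_mem (ih hn hV)
  | and φ ψ ih₁ ih₂ =>
    obtain ⟨h₁, h₂⟩ := max_le_iff.1 hn
    exact BooleanSubalgebra.inf_mem (ih₁ h₁ (Set.subset_union_left.trans hV))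
      (ih₂ h₂ (Set.subset_union_right.trans hV))
  | modal o φ ih =>
    exact app_mem_oneStepAlgebra o fun i =>
      ⟨φ i, depth_modal_le.1 hn i, (Set.subset_iUnion _ i).trans hV, rfl⟩

/-- The extension at a root depends only on the truth values of the variables that occur. -/
lemma mem_rootExt_congr {M : CoalgModel F V} {V₀ : Set V} {χ : Formula Λ V} (hV : χ.vars ⊆ V₀)
    {s s' : Set V} (hs : ∀ p ∈ V₀, p ∈ s ↔ p ∈ s') (t : F.obj M.frame.V) :
    (s, t) ∈ χ.rootExt sem M ↔ (s', t) ∈ χ.rootExt sem M := by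
  induction χ with
  | var p => exact hs p (hV rfl)
  | bot => rfl
  | neg φ ih => exact not_congr (ih hV)
  | and φ ψ ih₁ ih₂ =>
    exact and_congr (ih₁ (Set.subset_union_left.trans hV)) (ih₂ (Set.subset_union_right.trans hV))
  | modal o φ ih => rfl

lemma snd_preimage_mem_rootAlgebra {M : CoalgModel F V} {n : ℕ} {V₀ : Set V}
    {D : Set (F.obj M.frame.V)} (hD : D ∈ oneStepAlgebra sem (extAlgebra sem M n V₀)) :
    Prod.snd ⁻¹' D ∈ rootAlgebra sem M (n + 1) V₀ := by
  refine PropFormula.preimage_mem_of_mem_definable Prod.snd ?_ hD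
  rintro ⟨o, A⟩ hA
  choose χ hχ hχ' hχA using hA
  refine ⟨modal o χ, depth_modal_le.2 hχ, Set.iUnion_subset hχ', ?_⟩
  simp only [rootExt, hχA]
  rfl

lemma finite_extAlgebra [Finite Λ.Op] (M : CoalgModel F V) (n : ℕ) {V₀ : Set V} (hV₀ : V₀.Finite) :
    (extAlgebra sem M n V₀ : Set (Set M.frame.V)).Finite := by
  induction n with
  | zero =>
    refine (finite_of_profile (ι := Empty) fun _ => (∅ : Set M.frame.V)).subset ?_
    rintro _ ⟨χ, hn, -, rfl⟩ x y -
    revert x y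
    induction χ with
    | var p => simp [depth] at hn
    | bot => exact fun _ _ h => h
    | neg φ ih => exact fun x y hx hy => hx (ih hn y x hy)
    | and φ ψ ih₁ ih₂ =>
      obtain ⟨h₁, h₂⟩ := max_le_iff.1 hn
      exact fun x y h => ⟨ih₁ h₁ x y h.1, ih₂ h₂ x y h.2⟩
    | modal o φ => simp [depth] at hn
  | succ n ih =>
    have := hV₀.to_subtype
    have := ih.to_subtype
    refine (finite_of_profile (ι := V₀ ⊕ Σ o : Λ.Op, Fin (Λ.arity o) → extAlgebra sem M n V₀)
      (Sum.elim (fun p => M.val p)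
        (fun m => {x | M.frame.str x ∈ (sem m.1).app _ fun i => m.2 i}))).subset ?_
    rintro _ ⟨χ, hn, hV, rfl⟩ x y hxy
    suffices x ∈ χ.ext sem M ↔ y ∈ χ.ext sem M from this.1
    induction χ with
    | var p => exact hxy (.inl ⟨p, hV rfl⟩)
    | bot => rfl
    | neg φ ih => exact not_congr (ih hn hV)
    | and φ ψ ih₁ ih₂ =>
      obtain ⟨h₁, h₂⟩ := max_le_iff.1 hn
      exact and_congr (ih₁ h₁ (Set.subset_union_left.trans hV))
        (ih₂ h₂ (Set.subset_union_right.trans hV))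
    | modal o φ =>
      exact hxy (.inr ⟨o, fun i =>
        ⟨_, φ i, depth_modal_le.1 hn i, (Set.subset_iUnion _ i).trans hV, rfl⟩⟩)

/-! ### Uniform interpolation -/

/-- Interpolation with a bound on the depth of the interpolant. One-step interpolation, applied to
the extensions of formulas in a universal model, gives an interpolant of the slices of `φ` and `ψ`
for each choice of truth values of the common variables. -/
lemma exists_interpolant {M : CoalgModel F V} (hM : M.IsUniversal sem)
    (hint : OneStepInterpolation sem) (n : ℕ) (φ ψ : Formula Λ V) (hn : φ.depth ≤ n)
    (hφψ : φ.ext sem M ⊆ ψ.ext sem M) :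
    ∃ ρ : Formula Λ V, ρ.depth ≤ n ∧ ρ.vars ⊆ φ.vars ∩ ψ.vars ∧
      φ.ext sem M ⊆ ρ.ext sem M ∧ ρ.ext sem M ⊆ ψ.ext sem M := by
  induction n generalizing φ ψ with
  | zero => exact ⟨φ, hn, by simp [vars_eq_empty_of_depth hn], subset_rfl, hφψ⟩
  | succ n ih =>
    set V₁ := φ.vars
    set V₂ := ψ.vars
    have := φ.finite_vars.to_subtype
    have := ψ.finite_vars.to_subtype
    let m := max n ψ.depth
    let 𝔄₁ := extAlgebra sem M n V₁
    let 𝔄₂ := extAlgebra sem M m V₂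
    have hinter : ∀ A ∈ 𝔄₁, ∀ B ∈ 𝔄₂, A ⊆ B →
        ∃ C ∈ extAlgebra sem M n (V₁ ∩ V₂), A ⊆ C ∧ C ⊆ B := by
      rintro _ ⟨χ, hχ, hχ', rfl⟩ _ ⟨χ₂, hχ₂, hχ₂', rfl⟩ hle
      obtain ⟨ρ, hρ, hρ', h₁, h₂⟩ := ih χ χ₂ hχ hle
      exact ⟨_, ⟨ρ, hρ, hρ'.trans (Set.inter_subset_inter hχ' hχ₂'), rfl⟩, h₁, h₂⟩
    have hle₁ : extAlgebra sem M n (V₁ ∩ V₂) ≤ 𝔄₁ ⊓ 𝔄₂ := by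
      rintro _ ⟨χ, hχ, hχ', rfl⟩
      exact ⟨⟨χ, hχ, hχ'.trans Set.inter_subset_left, rfl⟩,
        ⟨χ, hχ.trans (le_max_left _ _), hχ'.trans Set.inter_subset_right, rfl⟩⟩
    have hle₂ : 𝔄₁ ⊓ 𝔄₂ ≤ extAlgebra sem M n (V₁ ∩ V₂) := by
      rintro A ⟨h₁, h₂⟩
      obtain ⟨C, hC, hAC, hCA⟩ := hinter A h₁ A h₂ subset_rfl
      rwa [hAC.antisymm hCA]
    have hI : Interpolable 𝔄₁ 𝔄₂ := fun A hA B hB hAB => by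
      obtain ⟨C, hC, h⟩ := hinter A hA B hB hAB
      exact ⟨C, hle₁ hC, h⟩
    have hroot := rootExt_subset_of_valid (hM.valid_imp hφψ) M
    -- The slices at all `s` that have the prescribed intersection with `V₁ ∩ V₂` are combined: into
    -- a union on the side of `φ` and into an intersection on the side of `ψ`. Both are finite
    -- combinations, as a slice of `φ` depends only on `s ∩ V₁`, and a slice of `ψ` on `s ∩ V₂`.
    have hslice : ∀ s₀ : Set ↥(V₁ ∩ V₂), ∃ D ∈ oneStepAlgebra sem (extAlgebra sem M n (V₁ ∩ V₂)),
        ∀ s, Subtype.val ⁻¹' s = s₀ → (∀ t, (s, t) ∈ φ.rootExt sem M → t ∈ D) ∧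
          ∀ t ∈ D, (s, t) ∈ ψ.rootExt sem M := by
      intro s₀
      let U : Set (F.obj M.frame.V) := {t | ∃ s, Subtype.val ⁻¹' s = s₀ ∧ (s, t) ∈ φ.rootExt sem M}
      let L : Set (F.obj M.frame.V) := {t | ∀ s, Subtype.val ⁻¹' s = s₀ → (s, t) ∈ ψ.rootExt sem M}
      have hcut : ∀ (W s : Set V), ∀ p ∈ W,
          p ∈ Subtype.val '' (Subtype.val ⁻¹' s : Set W) ↔ p ∈ s := by
        intro W s p hp
        simp [hp]
      have hU : U ∈ oneStepAlgebra sem 𝔄₁ := by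
        refine mem_of_profile (ι := Set V₁) _
          (fun c => slice_mem_oneStepAlgebra hn subset_rfl (Subtype.val '' c)) ?_
        rintro t t' htt' ⟨s, hs, hst⟩
        refine ⟨s, hs, ?_⟩
        rw [← mem_rootExt_congr subset_rfl (hcut φ.vars s)] at hst ⊢
        exact (htt' _).1 hst
      have hL : L ∈ oneStepAlgebra sem 𝔄₂ := by
        refine mem_of_profile (ι := Set V₂) _
          (fun c => slice_mem_oneStepAlgebra
            (show ψ.depth ≤ m + 1 from (le_max_right _ _).trans (Nat.le_succ _)) subset_rfl
            (Subtype.val '' c)) ?_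
        intro t t' htt' ht s hs
        have hst := ht s hs
        rw [← mem_rootExt_congr subset_rfl (hcut ψ.vars s)] at hst ⊢
        exact (htt' _).1 hst
      have hUL : U ⊆ L := by
        rintro t ⟨s, hs, hst⟩ s' hs'
        -- `s` and `s'` agree on `V₁ ∩ V₂`, so that they can be merged.
        have hagree : ∀ p, p ∈ V₁ → p ∈ V₂ → (p ∈ s ↔ p ∈ s') := fun p h₁ h₂ =>
          Set.ext_iff.1 (hs.trans hs'.symm) ⟨p, h₁, h₂⟩
        let r : Set V := s ∩ V₁ ∪ s' ∩ V₂
        have hr : (r, t) ∈ φ.rootExt sem M := by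
          rw [← mem_rootExt_congr subset_rfl (s := s)]
          · exact hst
          · intro p hp
            exact ⟨fun h => .inl ⟨h, hp⟩, fun h => h.elim And.left
              fun h => (hagree p hp h.2).2 h.1⟩
        have hr' := hroot hr
        rw [← mem_rootExt_congr subset_rfl (s := s')] at hr'
        · exact hr'
        · intro p hp
          exact ⟨fun h => .inr ⟨h, hp⟩, fun h => h.elim
            (fun h => (hagree p h.2 hp).1 h.1) And.left⟩
      obtain ⟨D, hD, hUD, hDL⟩ := oneStepInterpolation_iff.1 hint _ _ _ hI U hU L hL hUL
      exact ⟨D, oneStepAlgebra_mono hle₂ hD, fun s hs =>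
        ⟨fun t ht => hUD ⟨s, hs, ht⟩, fun t ht => hDL ht s hs⟩⟩
    choose D hD hDs using hslice
    have hE : {q : Set V × F.obj M.frame.V | q.2 ∈ D (Subtype.val ⁻¹' q.1)} ∈
        rootAlgebra sem M (n + 1) (V₁ ∩ V₂) := by
      have : Finite ↥(V₁ ∩ V₂) := (φ.finite_vars.inter_of_left _).to_subtype
      refine mem_of_profile (ι := ↥(V₁ ∩ V₂) ⊕ Set ↥(V₁ ∩ V₂)) _
        (G := Sum.elim (fun p => {q | p.1 ∈ q.1}) (fun s₀ => Prod.snd ⁻¹' D s₀)) ?_ ?_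
      · rintro (p | s₀)
        · exact ⟨var p, Nat.le_add_left _ _, Set.singleton_subset_iff.2 p.2, rfl⟩
        · exact snd_preimage_mem_rootAlgebra (hD s₀)
      · rintro q q' hqq' hq
        have : (Subtype.val ⁻¹' q'.1 : Set ↥(V₁ ∩ V₂)) = Subtype.val ⁻¹' q.1 :=
          Set.ext fun p => (hqq' (.inl p)).symm
        change q'.2 ∈ D (Subtype.val ⁻¹' q'.1)
        rw [this]
        exact (hqq' (.inr _)).1 hq
    obtain ⟨ρ, hρn, hρ, hρE⟩ := hE
    have hρE' : ∀ s t, (s, t) ∈ ρ.rootExt sem M ↔ t ∈ D (Subtype.val ⁻¹' s) :=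
      fun s t => by rw [hρE]; rfl
    refine ⟨ρ, hρn, hρ, fun x hx => ?_, fun x hx => ?_⟩
    · rw [mem_ext_iff_mem_rootExt] at hx ⊢
      exact (hρE' _ _).2 ((hDs _ _ rfl).1 _ hx)
    · rw [mem_ext_iff_mem_rootExt] at hx ⊢
      exact (hDs _ _ rfl).2 _ ((hρE' _ _).1 hx)

end Formula

/-- The uniform interpolant is the conjunction of the consequences of `φ` over the variables of `φ`
in `V₀` of at most the depth of `φ`: up to equivalence there are only finitely many. -/
theorem uniformInterpolation_of_oneStepInterpolation [Countable V] [Finite Λ.Op]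
    (hint : OneStepInterpolation sem) : UniformInterpolation V sem := by
  intro φ V₀
  obtain ⟨M, hM⟩ := exists_isUniversal (V := V) sem
  let 𝔅 := Formula.extAlgebra sem M φ.depth (φ.vars ∩ V₀)
  let S : Set (Set M.frame.V) := {A | A ∈ 𝔅 ∧ φ.ext sem M ⊆ A}
  have hS : S.Finite :=
    (Formula.finite_extAlgebra M φ.depth (φ.finite_vars.inter_of_left V₀)).subset fun _ h => h.1
  have := hS.to_subtype
  obtain ⟨ρ, -, hρV, hρ⟩ : ⋂₀ S ∈ 𝔅 := mem_of_profile (ι := S) 𝔅 (G := Subtype.val)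
    (fun A => A.2.1) (fun x y hxy hx A hA => (hxy ⟨A, hA⟩).1 (hx A hA))
  refine ⟨ρ, hρV.trans Set.inter_subset_right, ?_⟩
  rintro V₁ V₂ ψ hφ hψ rfl hφψ
  refine ⟨hM.valid_imp ?_, hM.valid_imp ?_⟩
  · rw [hρ]
    exact Set.subset_sInter fun A hA => hA.2
  · obtain ⟨χ, hχn, hχ, hφχ, hχψ⟩ := Formula.exists_interpolant hM hint _ φ ψ le_rfl
      (Formula.valid_imp_iff.1 hφψ M)
    have hχS : χ.ext sem M ∈ S := by
      refine ⟨⟨χ, hχn, fun p hp => ?_, rfl⟩, hφχ⟩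
      exact ⟨(hχ hp).1, hφ (hχ hp).1, hψ (hχ hp).2⟩
    rw [hρ]
    exact (Set.sInter_subset_of_mem hχS).trans hχψ

theorem interpolation_of_uniformInterpolation (h : UniformInterpolation V sem) :
    Interpolation V sem := by
  intro V₁ V₂ φ ψ hφ hψ hφψ
  obtain ⟨ρ, hρ, hρ'⟩ := h φ (V₁ ∩ V₂)
  exact ⟨ρ, hρ, hρ' V₁ V₂ ψ hφ hψ rfl hφψ⟩

end

/-! ### From interpolation to interpolation for the one-step logic -/

section

variable {F : Type u ⥤ Type u} {Λ : ModalSignature.{w}} {V : Type v}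
  {sem : Interpretation F Λ}

/-- The translation of propositional formulas into modal formulas that replaces each atom `z` by
the formula `e z`. -/
def PropFormula.toFormula {Z : Type*} (e : Z → Formula Λ V) : PropFormula Z → Formula Λ V
  | atom z => e z
  | bot => .bot
  | neg φ => .neg (φ.toFormula e)
  | and φ ψ => .and (φ.toFormula e) (ψ.toFormula e)

/-- One-step formulas as modal formulas. -/
def OneStepFormula.toFormula : OneStepFormula Λ V → Formula Λ V :=
  PropFormula.toFormula fun m => .modal m.op fun i => (m.args i).toFormula .var

lemma PropFormula.vars_toFormula_subset {Z : Type*} {e : Z → Formula Λ V} {S : Set Z} {V₀ : Set V}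
    (he : ∀ z ∈ S, (e z).vars ⊆ V₀) {φ : PropFormula Z} (hφ : φ ∈ overSet S) :
    (φ.toFormula e).vars ⊆ V₀ := by
  induction φ with
  | atom z => exact he z (hφ rfl)
  | bot => exact Set.empty_subset _
  | neg φ ih => exact ih hφ
  | and φ ψ ih₁ ih₂ =>
    exact Set.union_subset (ih₁ (Set.subset_union_left.trans hφ))
      (ih₂ (Set.subset_union_right.trans hφ))

lemma OneStepFormula.vars_toFormula_subset {V₀ : Set V} {φ : OneStepFormula Λ V}
    (hφ : φ ∈ OneStepFormula.overSet V₀) : φ.toFormula.vars ⊆ V₀ :=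
  PropFormula.vars_toFormula_subset (S := Modalized.overSet (PropFormula.overSet V₀))
    (fun _ hm => Set.iUnion_subset fun i => PropFormula.vars_toFormula_subset (S := V₀)
      (fun _ hp => Set.singleton_subset_iff.2 hp) (hm i)) hφ

lemma PropFormula.ext_toFormula_var (M : CoalgModel F V) (φ : PropFormula V) :
    (φ.toFormula .var).ext sem M = φ.ext M.val := by
  induction φ with
  | atom z => rfl
  | bot => rfl
  | neg φ ih => exact congrArg compl ih
  | and φ ψ ih₁ ih₂ => exact congrArg₂ (· ∩ ·) ih₁ ih₂

lemma OneStepFormula.rootExt_toFormula (M : CoalgModel F V) (φ : OneStepFormula Λ V) :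
    φ.toFormula.rootExt sem M = Prod.snd ⁻¹' φ.extension sem M.val := by
  induction φ with
  | atom m =>
    change {q : Set V × F.obj M.frame.V | q.2 ∈ (sem m.op).app M.frame.V
      fun i => ((m.args i).toFormula .var).ext sem M} = _
    simp only [PropFormula.ext_toFormula_var]
    rfl
  | bot => rfl
  | neg φ ih => exact congrArg compl ih
  | and φ ψ ih₁ ih₂ => exact congrArg₂ (· ∩ ·) ih₁ ih₂

lemma OneStepFormula.valid_imp_iff {φ ψ : OneStepFormula Λ V} :
    OneStepFormula.Valid sem (PropFormula.imp φ ψ) ↔ ∀ (X : Type u) (τ : V → Set X),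
      φ.extension sem τ ⊆ ψ.extension sem τ :=
  forall₂_congr fun _ _ => PropFormula.ext_imp_eq_univ

lemma PropFormula.ext_preimage {X Y : Type u} (f : X → Y) (τ : V → Set Y) (φ : PropFormula V) :
    φ.ext (fun p => f ⁻¹' τ p) = f ⁻¹' φ.ext τ := by
  induction φ with
  | atom z => rfl
  | bot => rfl
  | neg φ ih => exact congrArg compl ih
  | and φ ψ ih₁ ih₂ => exact congrArg₂ (· ∩ ·) ih₁ ih₂

lemma OneStepFormula.extension_preimage {X Y : Type u} (f : X ⟶ Y) (τ : V → Set Y)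
    (φ : OneStepFormula Λ V) :
    φ.extension sem (fun p => f ⁻¹' τ p) = F.map f ⁻¹' φ.extension sem τ := by
  induction φ with
  | atom m =>
    change (sem m.op).app X (fun i => (m.args i).ext fun p => f ⁻¹' τ p) =
      F.map f ⁻¹' (sem m.op).app Y (fun i => (m.args i).ext τ)
    simp only [PropFormula.ext_preimage]
    exact (sem m.op).natural X Y f _
  | bot => rfl
  | neg φ ih => exact congrArg compl ih
  | and φ ψ ih₁ ih₂ => exact congrArg₂ (· ∩ ·) ih₁ ih₂

/-- The model with a single state, no true variables, and structure `t₀`. -/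
def pointModel (V : Type v) (t₀ : F.obj PUnit.{u + 1}) : CoalgModel F V where
  frame := { V := PUnit.{u + 1}, str := ↾fun _ => t₀ }
  val _ := ∅

/-- The model on `X` with an additional state, in which every state has the additional state as its
only successor, with structure induced by `t₀`. The additional state satisfies no variables. -/
def collapseModel (t₀ : F.obj PUnit.{u + 1}) {X : Type u} (τ : V → Set X) : CoalgModel F V where
  frame := { V := Option X, str := ↾fun _ => F.map (↾fun _ : PUnit.{u + 1} => (none : Option X)) t₀ }
  val p := some '' τ p

lemma ext_pointModel (t₀ : F.obj PUnit.{u + 1}) {X : Type u} (τ : V → Set X) (χ : Formula Λ V) :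
    χ.ext sem (pointModel V t₀) =
      (fun _ : PUnit.{u + 1} => (none : Option X)) ⁻¹' χ.ext sem (collapseModel t₀ τ) :=
  χ.ext_eq_preimage (M := pointModel V t₀) (N := collapseModel t₀ τ)
    (↾fun _ : PUnit.{u + 1} => (none : Option X)) (fun _ => rfl) fun p => by
      refine (Set.eq_empty_of_forall_notMem ?_).symm
      rintro _ ⟨x, -, hx⟩
      exact Option.some_ne_none x hx

open scoped Classical in
/-- The propositional formula that results from replacing the outermost modal subformulas by their
truth values in the one-state model given by `t₀`. -/
noncomputable def Formula.flatten (sem : Interpretation F Λ) (t₀ : F.obj PUnit.{u + 1}) :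
    Formula Λ V → PropFormula V
  | var p => .atom p
  | bot => .bot
  | neg φ => .neg (φ.flatten sem t₀)
  | and φ ψ => .and (φ.flatten sem t₀) (ψ.flatten sem t₀)
  | modal o φ =>
    if PUnit.unit ∈ (modal o φ).ext sem (pointModel V t₀) then .neg .bot else .bot

/-- In the collapse model all states have the same structure, so that modal formulas have the same
truth value at all states. -/
lemma Formula.ext_flatten (t₀ : F.obj PUnit.{u + 1}) {X : Type u} (τ : V → Set X)
    (χ : Formula Λ V) :
    (χ.flatten sem t₀).ext τ = some ⁻¹' χ.ext sem (collapseModel t₀ τ) := by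
  induction χ with
  | var p => exact (Set.preimage_image_eq _ (Option.some_injective _)).symm
  | bot => rfl
  | neg φ ih => exact congrArg compl ih
  | and φ ψ ih₁ ih₂ => exact congrArg₂ (· ∩ ·) ih₁ ih₂
  | modal o φ =>
    have h : ∀ x : X, some x ∈ (modal o φ).ext sem (collapseModel t₀ τ) ↔
        PUnit.unit ∈ (modal o φ).ext sem (pointModel V t₀) := by
      intro x
      rw [ext_pointModel t₀ τ]
      rfl
    ext x
    refine Iff.trans ?_ (h x).symm
    rw [flatten]
    split_ifs with hx
    · exact iff_of_true (fun h => h) hx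
    · exact iff_of_false (fun h => h) hx

/-- The one-step formula that results from replacing variables outside of modal operators by `⊥` and
flattening the arguments of the outermost modal operators. -/
noncomputable def Formula.toOneStep (sem : Interpretation F Λ) (t₀ : F.obj PUnit.{u + 1}) :
    Formula Λ V → OneStepFormula Λ V
  | var _ => .bot
  | bot => .bot
  | neg φ => .neg (φ.toOneStep sem t₀)
  | and φ ψ => .and (φ.toOneStep sem t₀) (ψ.toOneStep sem t₀)
  | modal o φ => .atom ⟨o, fun i => (φ i).flatten sem t₀⟩

lemma Formula.flatten_mem_overSet {t₀ : F.obj PUnit.{u + 1}} {V₀ : Set V} {χ : Formula Λ V}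
    (hχ : χ.vars ⊆ V₀) : χ.flatten sem t₀ ∈ PropFormula.overSet V₀ := by
  induction χ with
  | var p => exact hχ
  | bot => exact Set.empty_subset _
  | neg φ ih => exact ih hχ
  | and φ ψ ih₁ ih₂ =>
    exact Set.union_subset (ih₁ (Set.subset_union_left.trans hχ))
      (ih₂ (Set.subset_union_right.trans hχ))
  | modal o φ =>
    rw [flatten]
    split_ifs <;> exact Set.empty_subset _

lemma Formula.toOneStep_mem_overSet {t₀ : F.obj PUnit.{u + 1}} {V₀ : Set V} {χ : Formula Λ V}
    (hχ : χ.vars ⊆ V₀) : χ.toOneStep sem t₀ ∈ OneStepFormula.overSet V₀ := by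
  induction χ with
  | var p => exact Set.empty_subset _
  | bot => exact Set.empty_subset _
  | neg φ ih => exact ih hχ
  | and φ ψ ih₁ ih₂ =>
    exact Set.union_subset (ih₁ (Set.subset_union_left.trans hχ))
      (ih₂ (Set.subset_union_right.trans hχ))
  | modal o φ =>
    exact Set.singleton_subset_iff.2 fun i =>
      flatten_mem_overSet ((Set.subset_iUnion _ i).trans hχ)

lemma Formula.mem_extension_toOneStep (t₀ : F.obj PUnit.{u + 1}) {X : Type u} (τ : V → Set X)
    (χ : Formula Λ V) (t : F.obj X) :
    t ∈ (χ.toOneStep sem t₀).extension sem τ ↔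
      ((∅ : Set V), F.map (↾(some : X → Option X)) t) ∈ χ.rootExt sem (collapseModel t₀ τ) := by
  induction χ with
  | var p => rfl
  | bot => rfl
  | neg φ ih => exact not_congr ih
  | and φ ψ ih₁ ih₂ => exact and_congr ih₁ ih₂
  | modal o φ =>
    refine Iff.trans ?_ (PredicateLifting.map_mem_app (sem o) (↾(some : X → Option X)) t
      fun i => (φ i).ext sem (collapseModel t₀ τ)).symm
    change t ∈ (sem o).app X (fun i => ((φ i).flatten sem t₀).ext τ) ↔ _
    simp only [ext_flatten]
    rfl

/-- An interpolant `ρ` in the full logic is turned into a one-step interpolant by evaluating `ρ` at a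
root over a model in which all modal formulas are constant. -/
theorem oneStepLogicInterpolation_of_interpolation (hint : Interpolation V sem) :
    OneStepLogicInterpolation V sem := by
  intro V₁ V₂ φ ψ hφ hψ hφψ
  rw [OneStepFormula.valid_imp_iff] at hφψ
  simp only [OneStepFormula.valid_imp_iff]
  rcases isEmpty_or_nonempty (F.obj PUnit.{u + 1}) with hempty | ⟨⟨t₀⟩⟩
  · -- Then all sets `F X` are empty.
    have hF : ∀ X, F.obj X → False := fun X t => hempty.false (F.map (↾fun _ => PUnit.unit) t)
    exact ⟨.bot, Set.empty_subset _, fun X _ t => (hF X t).elim, fun X _ t => (hF X t).elim⟩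
  have hvalid : (φ.toFormula.imp ψ.toFormula).Valid sem := by
    rw [Formula.valid_imp_iff]
    intro M x hx
    rw [Formula.mem_ext_iff_mem_rootExt, OneStepFormula.rootExt_toFormula] at hx ⊢
    exact hφψ _ _ hx
  obtain ⟨ρ, hρ, h₁, h₂⟩ := hint V₁ V₂ _ _ (OneStepFormula.vars_toFormula_subset hφ)
    (OneStepFormula.vars_toFormula_subset hψ) hvalid
  have key : ∀ (X : Type u) (τ : V → Set X) (t : F.obj X) (χ : OneStepFormula Λ V),
      t ∈ χ.extension sem τ ↔ ((∅ : Set V), F.map (↾(some : X → Option X)) t) ∈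
        χ.toFormula.rootExt sem (collapseModel t₀ τ) := by
    intro X τ t χ
    have hτ : τ = fun p => (↾(some : X → Option X)) ⁻¹' (some '' τ p) :=
      funext fun p => (Set.preimage_image_eq _ (Option.some_injective _)).symm
    rw [OneStepFormula.rootExt_toFormula]
    conv_lhs => rw [hτ, OneStepFormula.extension_preimage]
    rfl
  refine ⟨ρ.toOneStep sem t₀, Formula.toOneStep_mem_overSet hρ, fun X τ t ht => ?_,
    fun X τ t ht => ?_⟩
  · rw [Formula.mem_extension_toOneStep]
    exact Formula.rootExt_subset_of_valid h₁ _ ((key X τ t φ).1 ht)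
  · rw [Formula.mem_extension_toOneStep] at ht
    exact (key X τ t ψ).2 (Formula.rootExt_subset_of_valid h₂ _ ht)

end

end CoalgLogic

theorem mainTheorem2 {F : Type u ⥤ Type u} {Λ : CoalgLogic.ModalSignature.{w}}
    (sem : CoalgLogic.Interpretation F Λ) (V : Type v) [Countable V] [Finite Λ.Op] :
    (CoalgLogic.Separating sem ∧ CoalgLogic.PreservesFiniteSurjectiveWeakPullbacks F →
      CoalgLogic.OneStepInterpolation sem) ∧
    (CoalgLogic.OneStepInterpolation sem → CoalgLogic.UniformInterpolation V sem) ∧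
    (CoalgLogic.UniformInterpolation V sem → CoalgLogic.Interpolation V sem) ∧
    (CoalgLogic.Interpolation V sem → CoalgLogic.OneStepLogicInterpolation V sem) ∧
    (CoalgLogic.Monotonic sem → CoalgLogic.Separating sem →
      CoalgLogic.OneStepInterpolation sem →
      CoalgLogic.Separating sem ∧ CoalgLogic.PreservesFiniteSurjectiveWeakPullbacks F) :=
  ⟨fun h => CoalgLogic.oneStepInterpolation_of_preserves h.1 h.2,
    CoalgLogic.uniformInterpolation_of_oneStepInterpolation,
    CoalgLogic.interpolation_of_uniformInterpolation,
    CoalgLogic.oneStepLogicInterpolation_of_interpolation,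
    fun _ hsep hint => ⟨hsep, CoalgLogic.preserves_of_oneStepInterpolation hsep hint⟩⟩
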